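/- For $q$-uniform hypergraphs $F$ and $H$ (identified with their edge sets), a subgraph $G\subseteq F$ is called weakly $H$-saturated in $F$ if the edges of $F\setminus G$ can be ordered as $e_1,\dots,e_k$ so that for every $i\in\{1,\dots,k\}$ the hypergraph $G\cup\{e_1,\dots,e_i\}$ contains an isomorphic copy of $H$ which contains the edge $e_i$. Let $\mathrm{wsat}(F,H)$ be the minimum number of edges of a weakly $H$-saturated subgraph of $F$, and write $\mathrm{wsat}(n,H)$ when $F$ is the complete $q$-uniform hypergraph on $n$ vertices. Let $K^{d}_{r_1,\dots,r_d}$ be the complete $d$-partite $d$-uniform hypergraph with parts of sizes $r_1,\dots,r_d$. (a) For every finite bipartite graph $H$ with at least one edge, both of the following limits exist, are finite, and are equal: $$\lim_{n\to\infty}\frac{\mathrm{wsat}(n,H)}{n}=\lim_{n\to\infty}\frac{\mathrm{wsat}(K_{n,n},H)}{2n}.$$ (b) For all integers $d\ge 2$ and $1\le r_1\le\dots\le r_d$, as $n\to\infty$, $$\mathrm{wsat}(n,K^{d}_{r_1,\dots,r_d})=\frac{r_1-1}{(d-1)!}\,n^{d-1}+O(n^{d-2}),$$ where the implied constant may depend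 on $d$ and $r_1,\dots,r_d$. -/

import Mathlib

/-!
A hypergraph on the vertex set `V` is identified with its finite set of edges, a term of type
`Finset (Finset V)`; it is a `q`-graph if all its edges have size `q`.
-/

namespace WeakSat

/-- `G` is weakly `H`-saturated in `F`: `G ⊆ F`, and the edges of `F \ G` can be listed without
repetition as `e 0, …, e (k - 1)` so that for every `i` the hypergraph `G ∪ {e 0, …, e i}` contains
a copy of `H` (the image of `H` under an injection `f` of the vertices) which contains `e i`. -/
def IsWeaklySaturated {V W : Type*} (F : Finset (Finset V)) (H : Finset (Finset W))
    (G : Finset (Finset V)) : Prop :=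
  G ⊆ F ∧
  ∃ (k : ℕ) (e : Fin k → Finset V),
    Function.Injective e ∧
    (∀ x, (∃ i, e i = x) ↔ x ∈ F ∧ x ∉ G) ∧
    ∀ i, ∃ f : W ↪ V,
      (∀ s ∈ H, s.map f ∈ G ∨ ∃ j ≤ i, s.map f = e j) ∧
      (∃ s ∈ H, s.map f = e i)

/-- The weak saturation number of `H` in `F`: the minimum number of edges of a weakly `H`-saturated
subgraph of `F`. -/
noncomputable def wsat {V W : Type*} (F : Finset (Finset V)) (H : Finset (Finset W)) : ℕ :=
  sInf {m : ℕ | ∃ G : Finset (Finset V), IsWeaklySaturated F H G ∧ G.card = m}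

/-- The set in `wsat` is never empty (it contains `|F|`), so that `wsat` is a genuine minimum. -/
theorem isWeaklySaturated_self {V W : Type*} (F : Finset (Finset V)) (H : Finset (Finset W)) :
    IsWeaklySaturated F H F :=
  ⟨Finset.Subset.refl F, 0, Fin.elim0, fun i => i.elim0,
    fun _ => ⟨fun ⟨i, _⟩ => i.elim0, fun h => (h.2 h.1).elim⟩, fun i => i.elim0⟩

/-- The complete `q`-graph of order `n`. -/
def complete (q n : ℕ) : Finset (Finset (Fin n)) :=
  Finset.powersetCard q Finset.univ

/-- The complete `d`-partite `q`-graph with parts of sizes `r 0, …, r (d - 1)`: the edges are the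
`q`-element sets of vertices that meet every part in at most one vertex. -/
def completePartite (q : ℕ) {d : ℕ} (r : Fin d → ℕ) :
    Finset (Finset (Σ i : Fin d, Fin (r i))) :=
  (Finset.powersetCard q Finset.univ).filter
    fun e => ∀ i, (e.filter fun v => v.1 = i).card ≤ 1

open Classical in
/-- A finite simple graph as a `2`-graph: its edges are the sets `{u, v}` with `u` adjacent to
`v`. -/
noncomputable def ofGraph {V : Type*} [Fintype V] (G : SimpleGraph V) : Finset (Finset V) :=
  Finset.univ.filter fun e => ∃ u v, G.Adj u v ∧ e = {u, v}

end WeakSat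

/-! Enlarging a hypergraph never destroys a copy of `H`, so the order of additions is immaterial: `G
⊆ F` is weakly saturated exactly when the closure `Generates` contains `F`.

(a) Two disjoint complete graphs together with a clique on boundedly many of their vertices generate
all crossing edges. Hence `wsat` of complete graphs is subadditive up to a constant, and Fekete's
lemma gives the limit. A saturated subgraph of `K_{n,n}` plus two bounded cliques fills `K_{2n}`.
Conversely, a 2-colouring of `H` lifts its copies, so the bipartite double cover of a saturated
subgraph of `K_n` fills `K_{n,n}` with at most twice as many edges. The two comparisons squeeze the
second limit.

(b) Put `T = r 0 - 1`. For the lower bound, consider functions on edges that are sums of polynomials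
of degree less than `T` in one vertex (`polyLift`). On each copy of the partite hypergraph, products
of divided differences give a linear relation between their values, with nonzero coefficient at any
prescribed edge. A function vanishing on `G` therefore vanishes on everything generated, so `G` has
at least as many edges as the dimension of a suitable space of such functions. For the upper bound,
fix a copy of the vertex set and take all edges meeting it at least twice or meeting `T` chosen
vertices of its smallest part. -/

namespace WeakSat

/-- The edges which can be generated from `G` inside `F` by successively completing copies
of `H`. -/
inductive Generates {V W : Type*} (F : Finset (Finset V)) (H : Finset (Finset W))
    (G : Finset (Finset V)) : Finset V → Prop
  | mem {e : Finset V} : e ∈ G → Generates F H G e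
  | step {e : Finset V} (f : W ↪ V) : e ∈ F → (∃ s ∈ H, s.map f = e) →
      (∀ s ∈ H, s.map f ≠ e → Generates F H G (s.map f)) → Generates F H G e

/-! ### Weak saturation as a closure property -/

section Closure

variable {V W : Type*} {F G G' : Finset (Finset V)} {H : Finset (Finset W)} {e : Finset V}

theorem Generates.mono (hG : G ⊆ G') (h : Generates F H G e) : Generates F H G' e := by
  induction h with
  | mem h => exact .mem (hG h)
  | step f he hs _ ih => exact .step f he hs ih

theorem Generates.map {V' : Type*} {F' G' : Finset (Finset V')} (g : V ↪ V')
    (hF : ∀ e ∈ F, e.map g ∈ F') (hG : ∀ e ∈ G, e.map g ∈ G') (h : Generates F H G e) :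
    Generates F' H G' (e.map g) := by
  induction h with
  | mem h => exact .mem (hG _ h)
  | step f he hs _ ih =>
    refine .step (f.trans g) (hF _ he) ?_ ?_
    · obtain ⟨s, hs, rfl⟩ := hs
      exact ⟨s, hs, (Finset.map_map _ _ _).symm⟩
    · intro s hs' hne
      rw [← Finset.map_map] at hne ⊢
      exact ih s hs' fun h => hne (by rw [h])

theorem IsWeaklySaturated.generates (h : IsWeaklySaturated F H G) (he : e ∈ F) :
    Generates F H G e := by
  obtain ⟨-, k, x, -, hx, hstep⟩ := h
  have key : ∀ i : Fin k, Generates F H G (x i) := by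
    intro i
    induction i using WellFoundedLT.induction with
    | ind i ih =>
      obtain ⟨f, hf, hfe⟩ := hstep i
      refine .step f ((hx _).1 ⟨i, rfl⟩).1 hfe fun s hs hne => ?_
      rcases hf s hs with h | ⟨j, hj, h⟩
      · exact .mem h
      · rw [h] at hne ⊢
        exact ih j (lt_of_le_of_ne hj fun hji => hne (by rw [hji]))
  by_cases heG : e ∈ G
  · exact .mem heG
  · obtain ⟨i, rfl⟩ := (hx e).2 ⟨he, heG⟩
    exact key i

open Classical in
theorem IsWeaklySaturated.of_insert (he : e ∈ F) (heG : e ∉ G) (hG : G ⊆ F)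
    (hf : ∃ f : W ↪ V, (∀ s ∈ H, s.map f ∈ insert e G) ∧ ∃ s ∈ H, s.map f = e)
    (h : IsWeaklySaturated F H (insert e G)) : IsWeaklySaturated F H G := by
  obtain ⟨-, k, x, hinj, hx, hstep⟩ := h
  refine ⟨hG, k + 1, Fin.cons e x, ?_, ?_, ?_⟩
  · rw [Fin.cons_injective_iff]
    refine ⟨?_, hinj⟩
    rintro ⟨i, hi⟩
    exact ((hx e).1 ⟨i, hi⟩).2 (Finset.mem_insert_self _ _)
  · intro y
    rw [Fin.exists_fin_succ]
    simp only [Fin.cons_zero, Fin.cons_succ, hx, Finset.mem_insert, not_or]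
    constructor
    · rintro (rfl | h)
      · exact ⟨he, heG⟩
      · exact ⟨h.1, h.2.2⟩
    · rintro ⟨h1, h2⟩
      by_cases hy : e = y
      · exact .inl hy
      · exact .inr ⟨h1, fun h => hy h.symm, h2⟩
  · intro i
    refine Fin.cases ?_ (fun i => ?_) i
    · obtain ⟨f, h1, h2⟩ := hf
      refine ⟨f, fun s hs => ?_, h2⟩
      rcases Finset.mem_insert.1 (h1 s hs) with h | h
      · exact .inr ⟨0, le_rfl, h⟩
      · exact .inl h
    · obtain ⟨f, h1, h2⟩ := hstep i
      refine ⟨f, fun s hs => ?_, h2⟩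
      rcases h1 s hs with h | ⟨j, hj, h⟩
      · rcases Finset.mem_insert.1 h with h | h
        · exact .inr ⟨0, Fin.zero_le _, h⟩
        · exact .inl h
      · exact .inr ⟨j.succ, Fin.succ_le_succ_iff.2 hj, h⟩

/-- If no missing edge of `F` could be added at once, `G` would be closed under generation and
contain `F`. So some edge can be added, and induction on `|F \ G|` finishes. -/
theorem isWeaklySaturated_of_generates (hG : G ⊆ F) (h : ∀ e ∈ F, Generates F H G e) :
    IsWeaklySaturated F H G := by
  classical
  induction hn : (F \ G).card using Nat.strong_induction_on generalizing G with
  | _ n ih =>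
    by_cases hFG : F ⊆ G
    · rw [Finset.Subset.antisymm hG hFG]
      exact isWeaklySaturated_self F H
    · obtain ⟨e, he, heG, hf⟩ : ∃ e ∈ F, e ∉ G ∧
          ∃ f : W ↪ V, (∀ s ∈ H, s.map f ∈ insert e G) ∧ ∃ s ∈ H, s.map f = e := by
        by_contra! hcon
        refine hFG fun e he => ?_
        have hgen := h e he
        clear he
        induction hgen with
        | mem h => exact h
        | @step e f he hs _ ih =>
          by_contra heG
          obtain ⟨s, hs, hse⟩ := hs
          refine hcon e he heG f (fun s' hs' => ?_) s hs hse
          by_cases hne : s'.map f = e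
          · simp [hne]
          · exact Finset.mem_insert_of_mem (ih s' hs' hne)
      have hsub : insert e G ⊆ F := Finset.insert_subset he hG
      refine .of_insert he heG hG hf (ih _ ?_ hsub (fun x hx => ?_) rfl)
      · rw [← hn]
        refine Finset.card_lt_card ⟨Finset.sdiff_subset_sdiff le_rfl (Finset.subset_insert _ _),
          fun hss => ?_⟩
        have := hss (Finset.mem_sdiff.2 ⟨he, heG⟩)
        simp at this
      · exact (h x hx).mono (Finset.subset_insert _ _)

theorem wsat_le (hG : G ⊆ F) (h : ∀ e ∈ F, Generates F H G e) : wsat F H ≤ G.card :=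
  Nat.sInf_le ⟨G, isWeaklySaturated_of_generates hG h, rfl⟩

theorem exists_card_eq_wsat (F : Finset (Finset V)) (H : Finset (Finset W)) :
    ∃ G : Finset (Finset V), G ⊆ F ∧ (∀ e ∈ F, Generates F H G e) ∧ G.card = wsat F H := by
  obtain ⟨G, hG, hc⟩ := Nat.sInf_mem
    (s := {m : ℕ | ∃ G : Finset (Finset V), IsWeaklySaturated F H G ∧ G.card = m})
    ⟨_, F, isWeaklySaturated_self F H, rfl⟩
  exact ⟨G, hG.1, fun e he => hG.generates he, hc⟩

end Closure

/-! ### Bipartite graphs: comparing complete and complete bipartite hosts -/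

section Graphs

open Filter Topology

variable {V W : Type*} [DecidableEq V] [Fintype W] {F G : Finset (Finset V)} {H : SimpleGraph W}

theorem mem_ofGraph [Fintype V] {K : SimpleGraph V} {e : Finset V} :
    e ∈ ofGraph K ↔ ∃ u v, K.Adj u v ∧ e = {u, v} := by
  classical
  simp only [ofGraph, Finset.mem_filter, Finset.mem_univ, true_and]
  constructor <;> rintro ⟨u, v, h, rfl⟩ <;> exact ⟨u, v, h, by ext; simp⟩

theorem mem_complete_two {n : ℕ} {e : Finset (Fin n)} :
    e ∈ complete 2 n ↔ ∃ a b, a ≠ b ∧ e = {a, b} := by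
  simp [complete, Finset.card_eq_two]

theorem pair_mem_ofGraph_completeBipartiteGraph {n : ℕ} (u v : Fin n) :
    ({.inl u, .inr v} : Finset (Fin n ⊕ Fin n)) ∈
      ofGraph (completeBipartiteGraph (Fin n) (Fin n)) :=
  mem_ofGraph.2 ⟨_, _, by simp, rfl⟩

theorem mem_ofGraph_completeBipartiteGraph {n : ℕ} {e : Finset (Fin n ⊕ Fin n)} :
    e ∈ ofGraph (completeBipartiteGraph (Fin n) (Fin n)) ↔ ∃ u v, e = {.inl u, .inr v} := by
  constructor
  · rw [mem_ofGraph]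
    rintro ⟨u | u, v | v, h, rfl⟩
    · simp at h
    · exact ⟨u, v, rfl⟩
    · exact ⟨v, u, Finset.pair_comm _ _⟩
    · simp at h
  · rintro ⟨u, v, rfl⟩
    exact pair_mem_ofGraph_completeBipartiteGraph u v

theorem map_pair {V' : Type*} [DecidableEq V'] (f : V ↪ V') (u v : V) :
    ({u, v} : Finset V).map f = {f u, f v} := by
  ext; simp

theorem pair_eq_pair_iff {a b c d : V} :
    ({a, b} : Finset V) = {c, d} ↔ a = c ∧ b = d ∨ a = d ∧ b = c := by
  rw [← Finset.coe_inj]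
  push_cast
  exact Set.pair_eq_pair_iff

theorem Generates.of_adj {x y : W} (hxy : H.Adj x y) (f : W ↪ V) (he : {f x, f y} ∈ F)
    (h : ∀ u v, H.Adj u v → ({f u, f v} : Finset V) ≠ {f x, f y} →
      Generates F (ofGraph H) G {f u, f v}) :
    Generates F (ofGraph H) G {f x, f y} := by
  classical
  refine .step f he ⟨{x, y}, mem_ofGraph.2 ⟨x, y, hxy, rfl⟩, map_pair f x y⟩ fun s hs hne => ?_
  obtain ⟨u, v, huv, rfl⟩ := mem_ofGraph.1 hs
  rw [map_pair] at hne ⊢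
  exact h u v huv hne

/-- Send `x`, `y` to `a`, `b` and the other vertices of `H` into `S`: every other edge of this copy
lies in `S` or joins `S` to `a` or `b`. -/
theorem generates_pair_of_clique {x y : W} (hxy : H.Adj x y) {S : Finset V}
    (hS : Fintype.card W ≤ S.card) {a b : V} (hab : a ≠ b) (ha : a ∉ S) (hb : b ∉ S)
    (hF : {a, b} ∈ F)
    (hSS : ∀ u ∈ S, ∀ v ∈ S, u ≠ v → Generates F (ofGraph H) G {u, v})
    (haS : ∀ u ∈ S, Generates F (ofGraph H) G {a, u})
    (hbS : ∀ u ∈ S, Generates F (ofGraph H) G {b, u}) :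
    Generates F (ofGraph H) G {a, b} := by
  classical
  obtain ⟨g⟩ : Nonempty (W ↪ S) := by
    apply Function.Embedding.nonempty_of_card_le
    simpa using hS
  have hgS : ∀ w, (g w : V) ∈ S := fun w => (g w).2
  have hga : ∀ w, (g w : V) ≠ a := fun w h => ha (h ▸ hgS w)
  have hgb : ∀ w, (g w : V) ≠ b := fun w h => hb (h ▸ hgS w)
  let f : W → V := fun w => if w = x then a else if w = y then b else g w
  have hyx : y ≠ x := hxy.ne'
  have hfx : f x = a := by simp [f]
  have hfy : f y = b := by simp [f, hyx]
  have hf : ∀ w, w ≠ x → w ≠ y → f w = g w := fun w h1 h2 => by simp [f, h1, h2]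
  have hcases : ∀ w, w = x ∨ w = y ∨ (w ≠ x ∧ w ≠ y) := by intro w; tauto
  have hinj : Function.Injective f := by
    intro u v huv
    rcases hcases u with rfl | rfl | hu <;> rcases hcases v with rfl | rfl | hv
    · rfl
    · exact absurd (hfx.symm.trans (huv.trans hfy)) hab
    · rw [hfx, hf v hv.1 hv.2] at huv; exact absurd huv.symm (hga v)
    · exact absurd (hfx.symm.trans (huv.symm.trans hfy)) hab
    · rfl
    · rw [hfy, hf v hv.1 hv.2] at huv; exact absurd huv.symm (hgb v)
    · rw [hfx, hf u hu.1 hu.2] at huv; exact absurd huv (hga u)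
    · rw [hfy, hf u hu.1 hu.2] at huv; exact absurd huv (hgb u)
    · rw [hf u hu.1 hu.2, hf v hv.1 hv.2] at huv
      exact g.injective (Subtype.ext huv)
  have := Generates.of_adj (F := F) (G := G) hxy ⟨f, hinj⟩ (by simpa [hfx, hfy] using hF) ?_
  · simpa [hfx, hfy] using this
  · intro u v huv hne
    simp only [Function.Embedding.coeFn_mk, hfx, hfy] at hne ⊢
    rcases hcases u with rfl | rfl | hu <;> rcases hcases v with rfl | rfl | hv
    · exact absurd rfl huv.ne
    · exact absurd (by rw [hfx, hfy]) hne
    · rw [hfx, hf v hv.1 hv.2]; exact haS _ (hgS v)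
    · exact absurd (by rw [hfx, hfy, Finset.pair_comm]) hne
    · exact absurd rfl huv.ne
    · rw [hfy, hf v hv.1 hv.2]; exact hbS _ (hgS v)
    · rw [hfx, hf u hu.1 hu.2, Finset.pair_comm]; exact haS _ (hgS u)
    · rw [hfy, hf u hu.1 hu.2, Finset.pair_comm]; exact hbS _ (hgS u)
    · rw [hf u hu.1 hu.2, hf v hv.1 hv.2]
      exact hSS _ (hgS u) _ (hgS v) fun h => huv.ne (g.injective (Subtype.ext h))

theorem wsat_complete_two_add_le {x y : W} (hxy : H.Adj x y) (m n : ℕ) :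
    wsat (complete 2 (m + n)) (ofGraph H) ≤
      wsat (complete 2 m) (ofGraph H) + wsat (complete 2 n) (ofGraph H) +
        (2 * Fintype.card W).choose 2 := by
  classical
  set h := Fintype.card W with hh
  obtain ⟨G₁, hG₁, hg₁, hc₁⟩ := exists_card_eq_wsat (complete 2 m) (ofGraph H)
  obtain ⟨G₂, hG₂, hg₂, hc₂⟩ := exists_card_eq_wsat (complete 2 n) (ofGraph H)
  -- The minimum covers small `m`: either `A` is everything, or it is large enough to hold a copy of
  -- `H`.
  obtain ⟨A, hA⟩ : ∃ A : Finset (Fin m), A.card = min h m :=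
    (Finset.exists_subset_card_eq (s := Finset.univ) (by simp)).imp fun _ h => h.2
  obtain ⟨B, hB⟩ : ∃ B : Finset (Fin n), B.card = min h n :=
    (Finset.exists_subset_card_eq (s := Finset.univ) (by simp)).imp fun _ h => h.2
  let l : Fin m ↪ Fin (m + n) := Fin.castAddEmb n
  let r : Fin n ↪ Fin (m + n) := Fin.natAddEmb m
  have hlr : ∀ a b, l a ≠ r b := by
    intro a b hab
    have := congrArg Fin.val hab
    simp [l, r] at this
    omega
  let core := Finset.powersetCard 2 (A.map l ∪ B.map r)
  have hcore : core.card ≤ (2 * h).choose 2 := by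
    rw [Finset.card_powersetCard]
    refine Nat.choose_le_choose 2 ((Finset.card_union_le _ _).trans ?_)
    simp only [Finset.card_map]
    omega
  have hmapl : ∀ e ∈ complete 2 m, e.map l ∈ complete 2 (m + n) := by
    simp [complete]
  have hmapr : ∀ e ∈ complete 2 n, e.map r ∈ complete 2 (m + n) := by
    simp [complete]
  let G := G₁.image (·.map l) ∪ G₂.image (·.map r) ∪ core
  have hG : G ⊆ complete 2 (m + n) := by
    intro e he
    simp only [G, Finset.mem_union, Finset.mem_image] at he
    rcases he with (⟨e, he, rfl⟩ | ⟨e, he, rfl⟩) | he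
    · exact hmapl e (hG₁ he)
    · exact hmapr e (hG₂ he)
    · exact Finset.powersetCard_mono (Finset.subset_univ _) he
  have hll : ∀ a a', a ≠ a' → Generates (complete 2 (m + n)) (ofGraph H) G {l a, l a'} := by
    intro a a' haa
    rw [← map_pair]
    refine (hg₁ {a, a'} (mem_complete_two.2 ⟨a, a', haa, rfl⟩)).map l hmapl fun e he => ?_
    simp only [G, Finset.mem_union, Finset.mem_image]
    exact .inl (.inl ⟨e, he, rfl⟩)
  have hrr : ∀ b b', b ≠ b' → Generates (complete 2 (m + n)) (ofGraph H) G {r b, r b'} := by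
    intro b b' hbb
    rw [← map_pair]
    refine (hg₂ {b, b'} (mem_complete_two.2 ⟨b, b', hbb, rfl⟩)).map r hmapr fun e he => ?_
    simp only [G, Finset.mem_union, Finset.mem_image]
    exact .inl (.inr ⟨e, he, rfl⟩)
  have hlrF : ∀ a b, {l a, r b} ∈ complete 2 (m + n) := fun a b =>
    mem_complete_two.2 ⟨_, _, hlr a b, rfl⟩
  have hAB : ∀ a ∈ A, ∀ b ∈ B, Generates (complete 2 (m + n)) (ofGraph H) G {l a, r b} := by
    intro a ha b hb
    refine .mem (Finset.mem_union_right _ (Finset.mem_powersetCard.2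
      ⟨?_, Finset.card_pair (hlr a b)⟩))
    intro z hz
    rcases Finset.mem_insert.1 hz with rfl | hz
    · exact Finset.mem_union_left _ (Finset.mem_map_of_mem _ ha)
    · rw [Finset.mem_singleton.1 hz]
      exact Finset.mem_union_right _ (Finset.mem_map_of_mem _ hb)
  have hcardA : ∀ a, a ∉ A → h ≤ A.card := by
    intro a ha
    have h1 : A.card < Fintype.card (Fin m) := Finset.card_lt_univ_of_notMem ha
    rw [Fintype.card_fin] at h1
    omega
  have hcardB : ∀ b, b ∉ B → h ≤ B.card := by
    intro b hb
    have h1 : B.card < Fintype.card (Fin n) := Finset.card_lt_univ_of_notMem hb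
    rw [Fintype.card_fin] at h1
    omega
  -- Crossing edges arise in two rounds: the clique `A` first yields those ending in `B`, then the
  -- clique `B` yields all of them.
  have hlB : ∀ a, ∀ b ∈ B, Generates (complete 2 (m + n)) (ofGraph H) G {l a, r b} := by
    intro a b hb
    by_cases ha : a ∈ A
    · exact hAB a ha b hb
    refine generates_pair_of_clique hxy (S := A.map l) (by simpa using hcardA a ha) (hlr a b)
      (by simpa using ha) (by simp [hlr]) (hlrF a b) ?_ ?_ ?_
    · simp only [Finset.forall_mem_map]
      intro u _ v _ huv
      exact hll u v fun h => huv (by rw [h])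
    · simp only [Finset.forall_mem_map]
      intro u hu
      exact hll a u fun h => ha (h ▸ hu)
    · simp only [Finset.forall_mem_map]
      intro u hu
      rw [Finset.pair_comm]
      exact hAB u hu b hb
  have hall : ∀ a b, Generates (complete 2 (m + n)) (ofGraph H) G {l a, r b} := by
    intro a b
    by_cases hb : b ∈ B
    · exact hlB a b hb
    refine generates_pair_of_clique hxy (S := B.map r) (by simpa using hcardB b hb) (hlr a b)
      (by simp [(hlr _ _).symm]) (by simpa using hb) (hlrF a b) ?_ ?_ ?_
    · simp only [Finset.forall_mem_map]
      intro u _ v _ huv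
      exact hrr u v fun h => huv (by rw [h])
    · simp only [Finset.forall_mem_map]
      intro u hu
      exact hlB a u hu
    · simp only [Finset.forall_mem_map]
      intro u hu
      exact hrr b u fun h => hb (h ▸ hu)
  refine (wsat_le hG fun e he => ?_).trans ?_
  · obtain ⟨u, v, huv, rfl⟩ := mem_complete_two.1 he
    have hcov : ∀ z : Fin (m + n), (∃ a, z = l a) ∨ ∃ b, z = r b := fun z =>
      Fin.addCases (fun a => .inl ⟨a, rfl⟩) (fun b => .inr ⟨b, rfl⟩) z
    rcases hcov u with ⟨a, rfl⟩ | ⟨a, rfl⟩ <;> rcases hcov v with ⟨b, rfl⟩ | ⟨b, rfl⟩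
    · exact hll a b fun h => huv (by rw [h])
    · exact hall a b
    · rw [Finset.pair_comm]; exact hall b a
    · exact hrr a b fun h => huv (by rw [h])
  · refine (Finset.card_union_le _ _).trans (add_le_add ((Finset.card_union_le _ _).trans ?_) hcore)
    rw [← hc₁, ← hc₂]
    exact add_le_add Finset.card_image_le Finset.card_image_le

theorem wsat_complete_two_two_mul_le {x y : W} (hxy : H.Adj x y) {n : ℕ}
    (hn : Fintype.card W ≤ n) :
    wsat (complete 2 (2 * n)) (ofGraph H) ≤
      wsat (ofGraph (completeBipartiteGraph (Fin n) (Fin n))) (ofGraph H) +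
        2 * (Fintype.card W).choose 2 := by
  classical
  rw [two_mul n]
  set h := Fintype.card W with hh
  obtain ⟨G₁, hG₁, hg₁, hc₁⟩ := exists_card_eq_wsat
    (ofGraph (completeBipartiteGraph (Fin n) (Fin n))) (ofGraph H)
  obtain ⟨A, hA⟩ : ∃ A : Finset (Fin n), A.card = h :=
    (Finset.exists_subset_card_eq (s := Finset.univ) (by simpa using hn)).imp fun _ h => h.2
  let l : Fin n ↪ Fin (n + n) := Fin.castAddEmb n
  let r : Fin n ↪ Fin (n + n) := Fin.natAddEmb n
  have hlr : ∀ a b, l a ≠ r b := by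
    intro a b hab
    have := congrArg Fin.val hab
    simp [l, r] at this
    omega
  let φ : Fin n ⊕ Fin n ↪ Fin (n + n) := finSumFinEquiv.toEmbedding
  have hφl : ∀ a, φ (.inl a) = l a := fun a => finSumFinEquiv_apply_left a
  have hφr : ∀ a, φ (.inr a) = r a := fun a => finSumFinEquiv_apply_right a
  have hmap : ∀ e ∈ ofGraph (completeBipartiteGraph (Fin n) (Fin n)),
      e.map φ ∈ complete 2 (n + n) := by
    intro e he
    obtain ⟨u, v, rfl⟩ := mem_ofGraph_completeBipartiteGraph.1 he
    rw [map_pair, hφl, hφr]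
    exact mem_complete_two.2 ⟨_, _, hlr u v, rfl⟩
  let coreL := Finset.powersetCard 2 (A.map l)
  let coreR := Finset.powersetCard 2 (A.map r)
  let G := G₁.image (·.map φ) ∪ (coreL ∪ coreR)
  have hG : G ⊆ complete 2 (n + n) := by
    intro e he
    simp only [G, Finset.mem_union, Finset.mem_image] at he
    rcases he with ⟨e, he, rfl⟩ | he | he
    · exact hmap e (hG₁ he)
    · exact Finset.powersetCard_mono (Finset.subset_univ _) he
    · exact Finset.powersetCard_mono (Finset.subset_univ _) he
  have hlr' : ∀ a b, Generates (complete 2 (n + n)) (ofGraph H) G {l a, r b} := by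
    intro a b
    rw [← hφl, ← hφr, ← map_pair]
    refine (hg₁ _ (pair_mem_ofGraph_completeBipartiteGraph a b)).map φ hmap fun e he => ?_
    exact Finset.mem_union_left _ (Finset.mem_image_of_mem _ he)
  have hLL : ∀ z ∈ A.map l, ∀ w ∈ A.map l, z ≠ w →
      Generates (complete 2 (n + n)) (ofGraph H) G {z, w} := by
    intro z hz w hw hzw
    refine .mem (Finset.mem_union_right _ (Finset.mem_union_left _
      (Finset.mem_powersetCard.2 ⟨?_, Finset.card_pair hzw⟩)))
    exact Finset.insert_subset hz (Finset.singleton_subset_iff.2 hw)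
  have hRR : ∀ z ∈ A.map r, ∀ w ∈ A.map r, z ≠ w →
      Generates (complete 2 (n + n)) (ofGraph H) G {z, w} := by
    intro z hz w hw hzw
    refine .mem (Finset.mem_union_right _ (Finset.mem_union_right _
      (Finset.mem_powersetCard.2 ⟨?_, Finset.card_pair hzw⟩)))
    exact Finset.insert_subset hz (Finset.singleton_subset_iff.2 hw)
  refine (wsat_le hG fun e he => ?_).trans ?_
  · obtain ⟨u, v, huv, rfl⟩ := mem_complete_two.1 he
    have hcov : ∀ z : Fin (n + n), (∃ a, z = l a) ∨ ∃ b, z = r b := fun z =>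
      Fin.addCases (fun a => .inl ⟨a, rfl⟩) (fun b => .inr ⟨b, rfl⟩) z
    rcases hcov u with ⟨a, rfl⟩ | ⟨a, rfl⟩ <;> rcases hcov v with ⟨b, rfl⟩ | ⟨b, rfl⟩
    · refine generates_pair_of_clique hxy (S := A.map r) (by simp [hA, hh]) huv
        (by simp [(hlr _ _).symm]) (by simp [(hlr _ _).symm]) he hRR ?_ ?_ <;>
      · simp only [Finset.forall_mem_map]
        intro c _
        exact hlr' _ c
    · exact hlr' a b
    · rw [Finset.pair_comm]; exact hlr' b a
    · refine generates_pair_of_clique hxy (S := A.map l) (by simp [hA, hh]) huv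
        (by simp [hlr]) (by simp [hlr]) he hLL ?_ ?_ <;>
      · simp only [Finset.forall_mem_map]
        intro c _
        rw [Finset.pair_comm]
        exact hlr' c _
  · refine (Finset.card_union_le _ _).trans (add_le_add ?_ ((Finset.card_union_le _ _).trans ?_))
    · rw [← hc₁]
      exact Finset.card_image_le
    · simp only [coreL, coreR, Finset.card_powersetCard, Finset.card_map, hA]
      omega

/-- The bipartite double cover of a graph. -/
def doubleCover {n : ℕ} (G : Finset (Finset (Fin n))) : Finset (Finset (Fin n ⊕ Fin n)) :=
  G.biUnion fun e => e.offDiag.image fun p => {.inl p.1, .inr p.2}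

theorem pair_mem_doubleCover {n : ℕ} {G : Finset (Finset (Fin n))} {u v : Fin n} (huv : u ≠ v)
    (h : {u, v} ∈ G) : {.inl u, .inr v} ∈ doubleCover G := by
  simp only [doubleCover, Finset.mem_biUnion, Finset.mem_image, Finset.mem_offDiag]
  exact ⟨_, h, (u, v), ⟨by simp, by simp, huv⟩, rfl⟩

theorem card_doubleCover_le {n : ℕ} {G : Finset (Finset (Fin n))} (hG : G ⊆ complete 2 n) :
    (doubleCover G).card ≤ 2 * G.card := by
  rw [mul_comm]
  refine Finset.card_biUnion_le_card_mul _ _ _ fun e he => Finset.card_image_le.trans ?_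
  rw [Finset.offDiag_card, (Finset.mem_powersetCard.1 (hG he)).2]

/-- A copy of `H` lifts by placing its colour classes on opposite sides. Both lifts of an edge are
carried through the induction, since a later copy may need either one. -/
theorem Generates.doubleCover {n : ℕ} {G : Finset (Finset (Fin n))} (hG : G ⊆ complete 2 n)
    {c : W → Bool} (hc : ∀ u v, H.Adj u v → c u ≠ c v) {e : Finset (Fin n)}
    (he : Generates (complete 2 n) (ofGraph H) G e) :
    ∀ u v, e = {u, v} → Generates (ofGraph (completeBipartiteGraph (Fin n) (Fin n)))
      (ofGraph H) (doubleCover G) {.inl u, .inr v} := by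
  classical
  induction he with
  | mem h =>
    rintro u v rfl
    refine .mem (pair_mem_doubleCover ?_ h)
    rintro rfl
    have := (Finset.mem_powersetCard.1 (hG h)).2
    simp at this
  | @step e f he hs _ ih =>
    rintro u v rfl
    obtain ⟨s, hs, hsuv⟩ := hs
    obtain ⟨x, y, hxy, rfl, rfl⟩ : ∃ x y, H.Adj x y ∧ f x = u ∧ f y = v := by
      obtain ⟨x, y, hxy, rfl⟩ := mem_ofGraph.1 hs
      rw [map_pair] at hsuv
      have hne := hxy.ne
      rcases pair_eq_pair_iff.1 hsuv with h | h
      · exact ⟨x, y, hxy, h⟩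
      · exact ⟨y, x, hxy.symm, h.2, h.1⟩
    -- Comparing with `c x` puts `x` on the left, so that the new edge is the prescribed one of its
    -- two lifts.
    let g : W → Fin n ⊕ Fin n := fun w => if c w = c x then .inl (f w) else .inr (f w)
    have hg : Function.Injective g := by
      intro w w' hww
      simp only [g] at hww
      split_ifs at hww <;> simpa using hww
    have hgx : g x = .inl (f x) := by simp [g]
    have hgy : g y = .inr (f y) := by simp [g, (hc x y hxy).symm]
    have := Generates.of_adj (F := ofGraph (completeBipartiteGraph (Fin n) (Fin n)))
      (G := WeakSat.doubleCover G) hxy ⟨g, hg⟩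
      (by simpa [hgx, hgy] using pair_mem_ofGraph_completeBipartiteGraph _ _) ?_
    · simpa [hgx, hgy] using this
    have main : ∀ w w', H.Adj w w' → c w = c x → ({g w, g w'} : Finset _) ≠ {g x, g y} →
        Generates (ofGraph (completeBipartiteGraph (Fin n) (Fin n))) (ofGraph H)
          (WeakSat.doubleCover G) {g w, g w'} := by
      intro w w' hww hw hne
      have hw' : c w' ≠ c x := fun h => hc w w' hww (hw.trans h.symm)
      have h1 : g w = .inl (f w) := by simp [g, hw]
      have h2 : g w' = .inr (f w') := by simp [g, hw']
      rw [h1, h2]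
      refine ih {w, w'} (mem_ofGraph.2 ⟨w, w', hww, rfl⟩) (fun h => hne ?_) _ _ (map_pair _ _ _)
      rw [map_pair, pair_eq_pair_iff] at h
      simp only [f.injective.eq_iff] at h
      rcases h with ⟨rfl, rfl⟩ | ⟨rfl, rfl⟩
      · rfl
      · exact Finset.pair_comm _ _
    intro w w' hww hne
    simp only [Function.Embedding.coeFn_mk] at hne ⊢
    by_cases hw : c w = c x
    · exact main w w' hww hw hne
    · rw [Finset.pair_comm] at hne ⊢
      refine main w' w hww.symm ?_ hne
      have h1 := hc w w' hww
      revert hw h1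
      cases c w <;> cases c w' <;> cases c x <;> simp

/-- The double cover generates all edges except those joining the two lifts of one vertex `u`. Such
an edge closes a copy with `x` and `y` both above `u` and the other vertices above distinct points
different from `u`; `|W| < n` leaves room for them. -/
theorem wsat_completeBipartiteGraph_le {x y : W} (hxy : H.Adj x y) {c : W → Bool}
    (hc : ∀ u v, H.Adj u v → c u ≠ c v) {n : ℕ} (hn : Fintype.card W < n) :
    wsat (ofGraph (completeBipartiteGraph (Fin n) (Fin n))) (ofGraph H) ≤
      2 * wsat (complete 2 n) (ofGraph H) := by
  classical
  obtain ⟨G, hG, hg, hcard⟩ := exists_card_eq_wsat (complete 2 n) (ofGraph H)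
  rw [← hcard]
  refine (wsat_le ?_ ?_).trans (card_doubleCover_le hG)
  · intro e he
    simp only [doubleCover, Finset.mem_biUnion, Finset.mem_image] at he
    obtain ⟨_, _, p, _, rfl⟩ := he
    exact pair_mem_ofGraph_completeBipartiteGraph _ _
  intro e he
  have hoff : ∀ u v : Fin n, u ≠ v →
      Generates (ofGraph (completeBipartiteGraph (Fin n) (Fin n))) (ofGraph H)
        (doubleCover G) {.inl u, .inr v} := fun u v huv =>
    (hg _ (mem_complete_two.2 ⟨u, v, huv, rfl⟩)).doubleCover hG hc u v rfl
  obtain ⟨u, v, rfl⟩ := mem_ofGraph_completeBipartiteGraph.1 he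
  by_cases huv : u = v
  swap
  · exact hoff u v huv
  subst huv
  obtain ⟨k⟩ : Nonempty (W ↪ ({u}ᶜ : Finset (Fin n))) := by
    apply Function.Embedding.nonempty_of_card_le
    simp only [Fintype.card_coe, Finset.card_compl, Fintype.card_fin, Finset.card_singleton]
    omega
  have hku : ∀ w, (k w : Fin n) ≠ u := fun w h => by
    have := (k w).2
    rw [h] at this
    simp at this
  let f : W → Fin n := fun w => if w = x ∨ w = y then u else k w
  have hf : ∀ w w', c w = c w' → f w = f w' → w = w' := by
    intro w w' hcw hfw
    simp only [f] at hfw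
    have hcxy := hc x y hxy
    split_ifs at hfw with h1 h2 h2
    · rcases h1 with rfl | rfl <;> rcases h2 with rfl | rfl
      · rfl
      · exact absurd hcw hcxy
      · exact absurd hcw.symm hcxy
      · rfl
    · exact absurd hfw.symm (hku _)
    · exact absurd hfw (hku _)
    · exact k.injective (Subtype.ext hfw)
  let g : W → Fin n ⊕ Fin n := fun w => if c w = c x then .inl (f w) else .inr (f w)
  have hginj : Function.Injective g := by
    intro w w' hww
    simp only [g] at hww
    split_ifs at hww with h1 h2 h2
    · exact hf w w' (h1.trans h2.symm) (Sum.inl_injective hww)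
    · refine hf w w' ?_ (Sum.inr_injective hww)
      revert h1 h2
      cases c w <;> cases c w' <;> cases c x <;> simp
  have hgx : g x = .inl u := by simp [g, f]
  have hgy : g y = .inr u := by simp [g, f, (hc x y hxy).symm]
  have := Generates.of_adj (F := ofGraph (completeBipartiteGraph (Fin n) (Fin n)))
    (G := doubleCover G) hxy ⟨g, hginj⟩
    (by simpa [hgx, hgy] using pair_mem_ofGraph_completeBipartiteGraph _ _) ?_
  · simpa [hgx, hgy] using this
  have main : ∀ w w', H.Adj w w' → c w = c x → ({g w, g w'} : Finset _) ≠ {g x, g y} →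
      Generates (ofGraph (completeBipartiteGraph (Fin n) (Fin n))) (ofGraph H)
        (doubleCover G) {g w, g w'} := by
    intro w w' hww hw hne
    have hw' : c w' ≠ c x := fun h => hc w w' hww (hw.trans h.symm)
    have h1 : g w = .inl (f w) := by simp [g, hw]
    have h2 : g w' = .inr (f w') := by simp [g, hw']
    rw [h1, h2]
    refine hoff _ _ fun h => hne ?_
    have hcxy := hc x y hxy
    have hww' := hww.ne
    simp only [f] at h
    split_ifs at h with h3 h4 h4
    · rcases h3 with rfl | rfl
      · rcases h4 with rfl | rfl
        · exact absurd rfl hww'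
        · rfl
      · exact absurd hw.symm hcxy
    · exact absurd h.symm (hku _)
    · exact absurd h (hku _)
    · exact absurd (k.injective (Subtype.ext h)) hww'
  intro w w' hww hne
  simp only [Function.Embedding.coeFn_mk] at hne ⊢
  by_cases hw : c w = c x
  · exact main w w' hww hw hne
  · rw [Finset.pair_comm] at hne ⊢
    refine main w' w hww.symm ?_ hne
    have h1 := hc w w' hww
    revert hw h1
    cases c w <;> cases c w' <;> cases c x <;> simp

theorem exists_tendsto_wsat_complete_two_div {x y : W} (hxy : H.Adj x y) :
    ∃ c : ℝ, Tendsto (fun n : ℕ => (wsat (complete 2 n) (ofGraph H) : ℝ) / (n : ℝ))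
      atTop (𝓝 c) := by
  set C : ℕ := (2 * Fintype.card W).choose 2 with hC
  -- Adding `C` to each term absorbs the additive error, and `C / n` tends to zero.
  have hsub : Subadditive fun n => (wsat (complete 2 n) (ofGraph H) : ℝ) + C := by
    intro m n
    have := wsat_complete_two_add_le hxy m n
    have h : (wsat (complete 2 (m + n)) (ofGraph H) : ℝ) ≤
        wsat (complete 2 m) (ofGraph H) + wsat (complete 2 n) (ofGraph H) + C := by
      exact_mod_cast this
    linarith
  have hlim := hsub.tendsto_lim ⟨0, by rintro _ ⟨n, rfl⟩; positivity⟩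
  refine ⟨hsub.lim, ?_⟩
  have h0 := hlim.sub (tendsto_const_div_atTop_nhds_zero_nat (C : ℝ))
  rw [sub_zero] at h0
  refine h0.congr fun n => ?_
  ring

theorem exists_tendsto_wsat_bipartite (hH : H.IsBipartite) (hne : H ≠ ⊥) :
    ∃ c : ℝ,
      Tendsto (fun n : ℕ => (wsat (complete 2 n) (ofGraph H) : ℝ) / (n : ℝ)) atTop (𝓝 c) ∧
      Tendsto (fun n : ℕ => (wsat (ofGraph (completeBipartiteGraph (Fin n) (Fin n)))
        (ofGraph H) : ℝ) / (2 * (n : ℝ))) atTop (𝓝 c) := by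
  obtain ⟨x, y, hxy⟩ := SimpleGraph.ne_bot_iff_exists_adj.1 hne
  obtain ⟨col⟩ := hH
  obtain ⟨c, hc⟩ : ∃ c : W → Bool, ∀ u v, H.Adj u v → c u ≠ c v :=
    ⟨fun w => finTwoEquiv (col w), fun u v huv h => col.valid huv (finTwoEquiv.injective h)⟩
  obtain ⟨L, hL⟩ := exists_tendsto_wsat_complete_two_div hxy
  refine ⟨L, hL, ?_⟩
  set C : ℕ := 2 * (Fintype.card W).choose 2
  have hdouble : Tendsto (fun n : ℕ => 2 * n) atTop atTop :=
    tendsto_id.const_mul_atTop' (by norm_num)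
  have hlow := (hL.comp hdouble).sub
    ((tendsto_const_div_atTop_nhds_zero_nat (C : ℝ)).comp hdouble)
  rw [sub_zero] at hlow
  refine tendsto_of_tendsto_of_tendsto_of_le_of_le' hlow hL ?_ ?_
  · filter_upwards [eventually_ge_atTop (Fintype.card W)] with n hn
    have h : (wsat (complete 2 (2 * n)) (ofGraph H) : ℝ) ≤
        wsat (ofGraph (completeBipartiteGraph (Fin n) (Fin n))) (ofGraph H) + C := by
      exact_mod_cast wsat_complete_two_two_mul_le hxy hn
    simp only [Function.comp_apply, Nat.cast_mul, Nat.cast_ofNat]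
    rw [← sub_div]
    gcongr
    linarith
  · filter_upwards [eventually_gt_atTop (Fintype.card W)] with n hn
    have h : (wsat (ofGraph (completeBipartiteGraph (Fin n) (Fin n))) (ofGraph H) : ℝ) ≤
        2 * wsat (complete 2 n) (ofGraph H) := by
      exact_mod_cast wsat_completeBipartiteGraph_le hxy hc hn
    have hn0 : (0 : ℝ) < n := by exact_mod_cast (Nat.zero_le _).trans_lt hn
    rw [div_le_div_iff₀ (by positivity) hn0]
    nlinarith

end Graphs

/-! ### Edges of the complete multipartite hypergraph as choice functions -/

section Transversal

variable {d : ℕ} {r : Fin d → ℕ}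

/-- The edge of the complete multipartite hypergraph with vertex `p i` in part `i`. -/
def transversal (p : ∀ i, Fin (r i)) : Finset (Σ i, Fin (r i)) :=
  Finset.univ.map ⟨fun i => ⟨i, p i⟩, fun _ _ h => congrArg Sigma.fst h⟩

theorem mem_transversal {p : ∀ i, Fin (r i)} {x : Σ i, Fin (r i)} :
    x ∈ transversal p ↔ ∃ i, ⟨i, p i⟩ = x := by
  simp only [transversal, Finset.mem_map, Finset.mem_univ, true_and]
  rfl

theorem mem_transversal_iff {p : ∀ i, Fin (r i)} {i : Fin d} {j : Fin (r i)} :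
    ⟨i, j⟩ ∈ transversal p ↔ j = p i := by
  rw [mem_transversal]
  constructor
  · rintro ⟨i', h⟩
    cases h
    rfl
  · rintro rfl
    exact ⟨i, rfl⟩

theorem transversal_injective : Function.Injective (transversal (r := r)) := by
  intro p q h
  funext i
  rw [← mem_transversal_iff, ← h, mem_transversal_iff]

theorem mem_completePartite {s : Finset (Σ i, Fin (r i))} :
    s ∈ completePartite d r ↔ ∃ p, transversal p = s := by
  simp only [completePartite, Finset.mem_filter, Finset.mem_powersetCard, Finset.subset_univ,
    true_and]
  constructor
  · rintro ⟨hs, h⟩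
    have hinj : Set.InjOn Sigma.fst (s : Set (Σ i, Fin (r i))) := by
      intro x hx y hy hxy
      refine Finset.card_le_one.1 (h y.1) x ?_ y ?_
      · simpa using ⟨hx, hxy⟩
      · simpa using hy
    have himg : s.image Sigma.fst = Finset.univ := by
      apply Finset.eq_univ_of_card
      rw [Finset.card_image_of_injOn hinj, hs, Fintype.card_fin]
    have hex : ∀ i, ∃ j : Fin (r i), ⟨i, j⟩ ∈ s := by
      intro i
      obtain ⟨⟨i', j⟩, hx, rfl⟩ := Finset.mem_image.1 (himg ▸ Finset.mem_univ i)
      exact ⟨j, hx⟩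
    choose p hp using hex
    refine ⟨p, Finset.eq_of_subset_of_card_le ?_ ?_⟩
    · intro x hx
      obtain ⟨i, rfl⟩ := mem_transversal.1 hx
      exact hp i
    · simp [hs, transversal]
  · rintro ⟨p, rfl⟩
    refine ⟨by simp [transversal], fun i => Finset.card_le_one.2 ?_⟩
    rintro ⟨i₁, j₁⟩ h₁ ⟨i₂, j₂⟩ h₂
    simp only [Finset.mem_filter, mem_transversal_iff] at h₁ h₂
    obtain ⟨rfl, rfl⟩ := h₁
    obtain ⟨rfl, h⟩ := h₂
    cases h
    rfl

end Transversal

/-! ### Lower bound by linear algebra -/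

section LowerBound

/-- These are the weights of a divided difference on `t` nodes including `x`: it computes the
coefficient of degree `t - 1` of the interpolant, which is zero for `X ^ k`. -/
theorem exists_weights {N : ℕ} {a : Fin N → ℚ} (ha : Function.Injective a) {t : ℕ} (ht : 1 ≤ t)
    (htN : t ≤ N) (x : Fin N) :
    ∃ c : Fin N → ℚ, c x ≠ 0 ∧ ∀ k, k + 1 < t → ∑ j, c j * a j ^ k = 0 := by
  obtain ⟨A, hxA, -, hA⟩ := Finset.exists_subsuperset_card_eq (s := {x}) (t := Finset.univ)
    (n := t) (Finset.subset_univ _) (by simpa using ht) (by simpa using htN)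
  rw [Finset.singleton_subset_iff] at hxA
  refine ⟨fun j => if j ∈ A then (∏ l ∈ A.erase j, (a j - a l))⁻¹ else 0, ?_, fun k hk => ?_⟩
  · simp only [hxA, if_true]
    refine inv_ne_zero (Finset.prod_ne_zero_iff.2 fun l hl => sub_ne_zero.2 fun h => ?_)
    exact (Finset.mem_erase.1 hl).1 (ha h).symm
  · have h := Lagrange.coeff_eq_sum (s := A) (v := a) ha.injOn
      (P := (Polynomial.X : Polynomial ℚ) ^ k)
      (by rw [Polynomial.degree_X_pow, hA]; exact_mod_cast by omega)
    rw [hA, Polynomial.coeff_X_pow, if_neg (by omega)] at h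
    refine Eq.trans ?_ h.symm
    simp only [ite_mul, zero_mul, Finset.sum_ite_mem, Finset.univ_inter]
    exact Finset.sum_congr rfl fun j _ => by simp [div_eq_inv_mul]

/-- The function on edges obtained from functions `g k` on the sets with one vertex less. It is a
sum of functions each of which is a polynomial of degree less than `T` in one of the vertices. -/
def polyLift {n T : ℕ} (g : Fin T → Finset (Fin n) → ℚ) (e : Finset (Fin n)) : ℚ :=
  ∑ x ∈ e, ∑ k : Fin T, ((x : ℕ) : ℚ) ^ (k : ℕ) * g k (e.erase x)

variable {m n T : ℕ} {r : Fin (m + 1) → ℕ}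

theorem map_transversal_insertNth_erase (f : (Σ i, Fin (r i)) ↪ Fin n) (i : Fin (m + 1))
    (x : Fin (r i)) (q : ∀ j, Fin (r (i.succAbove j))) :
    ((transversal (i.insertNth (α := fun i => Fin (r i)) x q)).map f).erase (f ⟨i, x⟩) =
      Finset.univ.image fun j => f ⟨i.succAbove j, q j⟩ := by
  ext y
  simp only [Finset.mem_erase, Finset.mem_map, mem_transversal, Finset.mem_image, Finset.mem_univ,
    true_and, Fin.exists_iff_succAbove i,
    Fin.insertNth_apply_same, Fin.insertNth_apply_succAbove]
  constructor
  · rintro ⟨h1, z, rfl | ⟨j, rfl⟩, rfl⟩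
    · exact absurd rfl h1
    · exact ⟨j, rfl⟩
  · rintro ⟨j, rfl⟩
    refine ⟨fun h => ?_, _, .inr ⟨j, rfl⟩, rfl⟩
    exact Fin.succAbove_ne i j (congrArg Sigma.fst (f.injective h))

/-- In the summand for the vertex in part `i`, the choice `p i` enters only through `c i (p i)` and
a power below `T`, because erasing that vertex removes it from `g`. Summing over `p i` alone already
gives zero. -/
theorem sum_weights_mul_polyLift (f : (Σ i, Fin (r i)) ↪ Fin n) (c : ∀ i, Fin (r i) → ℚ)
    (hc : ∀ i, ∀ k < T, ∑ j, c i j * ((f ⟨i, j⟩ : ℕ) : ℚ) ^ k = 0)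
    (g : Fin T → Finset (Fin n) → ℚ) :
    ∑ p : ∀ i, Fin (r i), (∏ i, c i (p i)) * polyLift g ((transversal p).map f) = 0 := by
  have hexp : ∀ p : ∀ i, Fin (r i), (∏ i, c i (p i)) * polyLift g ((transversal p).map f) =
      ∑ i, ∑ k : Fin T, (∏ i, c i (p i)) * (((f ⟨i, p i⟩ : ℕ) : ℚ) ^ (k : ℕ) *
        g k (((transversal p).map f).erase (f ⟨i, p i⟩))) := by
    intro p
    rw [polyLift, Finset.sum_map, Finset.mul_sum]
    conv_lhs => rw [transversal, Finset.sum_map]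
    simp only [Finset.mul_sum]
    rfl
  simp only [hexp]
  rw [Finset.sum_comm]
  refine Finset.sum_eq_zero fun i _ => ?_
  rw [Finset.sum_comm]
  refine Finset.sum_eq_zero fun k _ => ?_
  rw [← (Fin.insertNthEquiv (fun i => Fin (r i)) i).sum_comp, Fintype.sum_prod_type_right]
  refine Finset.sum_eq_zero fun q _ => ?_
  have heq : ∀ x, Fin.insertNthEquiv (fun i => Fin (r i)) i (x, q) =
      i.insertNth (α := fun i => Fin (r i)) x q := fun _ => rfl
  simp only [heq, Fin.insertNth_apply_same, map_transversal_insertNth_erase,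
    Fin.prod_univ_succAbove _ i, Fin.insertNth_apply_succAbove]
  have := hc i k k.2
  calc _ = ∑ x, ((∏ j, c (i.succAbove j) (q j)) *
        g k (Finset.univ.image fun j => f ⟨i.succAbove j, q j⟩)) *
          (c i x * ((f ⟨i, x⟩ : ℕ) : ℚ) ^ (k : ℕ)) :=
        Finset.sum_congr rfl fun x _ => by ring
    _ = 0 := by rw [← Finset.mul_sum, this, mul_zero]

theorem Generates.polyLift_eq_zero {F G : Finset (Finset (Fin n))} (hr : ∀ i, T + 1 ≤ r i)
    {g : Fin T → Finset (Fin n) → ℚ} (hg : ∀ e ∈ G, polyLift g e = 0) {e : Finset (Fin n)}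
    (he : Generates F (completePartite (m + 1) r) G e) : polyLift g e = 0 := by
  induction he with
  | mem h => exact hg _ h
  | @step e f _ hs _ ih =>
    obtain ⟨s, hs, rfl⟩ := hs
    obtain ⟨p, rfl⟩ := mem_completePartite.1 hs
    -- The weights are adapted to the new edge `p`: its coefficient is nonzero, while all other
    -- edges of the copy contribute zero by induction.
    have hw : ∀ i, ∃ c : Fin (r i) → ℚ, c (p i) ≠ 0 ∧
        ∀ k, k + 1 < T + 1 → ∑ j, c j * ((f ⟨i, j⟩ : ℕ) : ℚ) ^ k = 0 := by
      intro i
      refine exists_weights (a := fun j => ((f ⟨i, j⟩ : ℕ) : ℚ)) ?_ (by omega) (hr i) (p i)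
      intro j j' h
      have h1 := f.injective (Fin.ext (Nat.cast_injective h))
      simpa using h1
    choose c hcp hc using hw
    have hsum := sum_weights_mul_polyLift f c (fun i k hk => hc i k (by omega)) g
    rw [Finset.sum_eq_single p] at hsum
    · exact (mul_eq_zero.1 hsum).resolve_left (Finset.prod_ne_zero_iff.2 fun i _ => hcp i)
    · intro q _ hq
      rw [ih _ (mem_completePartite.2 ⟨q, rfl⟩), mul_zero]
      intro h
      exact hq (transversal_injective (Finset.map_injective f h))
    · simp

/-- Let the `g k` be arbitrary on the `m`-sets avoiding the first `T` vertices and zero elsewhere.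
Restricting the lift to a saturated `G` is injective on this space, whose dimension is the left-hand
side. -/
theorem mul_choose_le_wsat (hr : ∀ i, T + 1 ≤ r i) (hT : T ≤ n) :
    T * (n - T).choose m ≤ wsat (complete (m + 1) n) (completePartite (m + 1) r) := by
  classical
  obtain ⟨G, -, hgen, hcard⟩ :=
    exists_card_eq_wsat (complete (m + 1) n) (completePartite (m + 1) r)
  rw [← hcard]
  let ι : Fin T ↪ Fin n := Fin.castLEEmb hT
  let S : Finset (Finset (Fin n)) := Finset.powersetCard m (Finset.univ.map ι)ᶜ
  let ext : (Fin T × S → ℚ) → Fin T → Finset (Fin n) → ℚ := fun u k s =>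
    if h : s ∈ S then u (k, ⟨s, h⟩) else 0
  let L : (Fin T × S → ℚ) →ₗ[ℚ] (G → ℚ) :=
    { toFun := fun u e => polyLift (ext u) e
      map_add' := by
        intro u v
        funext e
        simp only [polyLift, Pi.add_apply, ← Finset.sum_add_distrib]
        refine Finset.sum_congr rfl fun x _ => Finset.sum_congr rfl fun k _ => ?_
        by_cases h : (e : Finset (Fin n)).erase x ∈ S <;> simp [ext, h, mul_add]
      map_smul' := by
        intro a u
        funext e
        simp only [polyLift, Pi.smul_apply, smul_eq_mul, RingHom.id_apply, Finset.mul_sum]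
        refine Finset.sum_congr rfl fun x _ => Finset.sum_congr rfl fun k _ => ?_
        by_cases h : (e : Finset (Fin n)).erase x ∈ S <;> simp [ext, h, mul_left_comm] }
  have hinj : Function.Injective L := by
    rw [← LinearMap.ker_eq_bot, LinearMap.ker_eq_bot']
    intro u hu
    have hG : ∀ e ∈ G, polyLift (ext u) e = 0 := fun e he => congrFun hu ⟨e, he⟩
    have hall : ∀ e ∈ complete (m + 1) n, polyLift (ext u) e = 0 := fun e he =>
      (hgen e he).polyLift_eq_zero hr hG
    have hS : ∀ s : S, (fun k => u (k, s)) = 0 := by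
      rintro ⟨s, hs⟩
      obtain ⟨hs1, hs2⟩ := Finset.mem_powersetCard.1 hs
      -- On the edge `insert (ι j) s` the lift equals the polynomial with coefficients `u (k, s)` at
      -- `j`; vanishing at `T` distinct points forces these to be zero by Vandermonde.
      refine Matrix.eq_zero_of_forall_index_sum_mul_pow_eq_zero
        (f := fun j : Fin T => ((j : ℕ) : ℚ)) (fun i j h => Fin.ext (Nat.cast_injective h))
        fun j => ?_
      have hjs : ι j ∉ s := fun h => by simpa using hs1 h
      have h := hall (insert (ι j) s) (by
        simp [complete, Finset.card_insert_of_notMem hjs, hs2])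
      rw [polyLift, Finset.sum_insert hjs, Finset.erase_insert hjs,
        Finset.sum_eq_zero (s := s), add_zero] at h
      · rw [← h]
        refine Finset.sum_congr rfl fun k _ => ?_
        simp [ext, hs, ι, mul_comm]
      · intro x hx
        refine Finset.sum_eq_zero fun k _ => ?_
        have hnot : (insert (ι j) s).erase x ∉ S := by
          intro hmem
          have h1 : ι j ∈ (insert (ι j) s).erase x :=
            Finset.mem_erase.2 ⟨fun h => hjs (h ▸ hx), Finset.mem_insert_self _ _⟩
          simpa using (Finset.mem_powersetCard.1 hmem).1 h1
        simp [ext, hnot]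
    funext ⟨k, s⟩
    exact congrFun (hS s) k
  have hle := LinearMap.finrank_le_finrank_of_injective hinj
  rw [Module.finrank_fintype_fun_eq_card, Module.finrank_fintype_fun_eq_card, Fintype.card_prod,
    Fintype.card_fin, Fintype.card_coe, Fintype.card_coe] at hle
  simpa [S, Finset.card_compl] using hle

end LowerBound

/-! ### Upper bound by an explicit construction -/

section UpperBound

theorem exists_embedding_map_univ_eq {V : Type*} {d : ℕ} {e : Finset V} (he : e.card = d + 1)
    {x : V} (hx : x ∈ e) : ∃ v : Fin (d + 1) ↪ V, v 0 = x ∧ Finset.univ.map v = e := by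
  let E : e ≃ Fin (d + 1) := e.equivFinOfCardEq he
  let E' : Fin (d + 1) ≃ e := (Equiv.swap 0 (E ⟨x, hx⟩)).trans E.symm
  refine ⟨E'.toEmbedding.trans (Function.Embedding.subtype _), ?_, ?_⟩
  · simp [E']
  · rw [← Finset.map_map, Finset.map_univ_equiv, ← Finset.attach_eq_univ, Finset.attach_map_val]

theorem map_univ_mem_complete {d n : ℕ} (v : Fin d ↪ Fin n) :
    Finset.univ.map v ∈ complete d n := by
  simp [complete]

/-- In the core copy `ι`, replace the base vertex `z i` of each part by `v i`. Every edge of the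
resulting copy other than `v` itself still uses a non-base core vertex. -/
theorem Generates.of_core {d n : ℕ} {r : Fin d → ℕ} {G : Finset (Finset (Fin n))}
    (z : ∀ i, Fin (r i)) (ι : (Σ i, Fin (r i)) ↪ Fin n) (v : Fin d ↪ Fin n)
    (hv : ∀ i i' j, j ≠ z i' → v i ≠ ι ⟨i', j⟩)
    (h : ∀ w : Fin d ↪ Fin n, (∀ i, w i = v i ∨ ∃ j ≠ z i, w i = ι ⟨i, j⟩) →
      (∃ i, ∃ j ≠ z i, w i = ι ⟨i, j⟩) →
      Generates (complete d n) (completePartite d r) G (Finset.univ.map w)) :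
    Generates (complete d n) (completePartite d r) G (Finset.univ.map v) := by
  let f : (Σ i, Fin (r i)) → Fin n := fun x => if x.2 = z x.1 then v x.1 else ι x
  have hf : Function.Injective f := by
    rintro ⟨i, j⟩ ⟨i', j'⟩ hij
    simp only [f] at hij
    split_ifs at hij with h1 h2 h2
    · obtain rfl := v.injective hij
      rw [h1, h2]
    · exact absurd hij (hv i i' j' h2)
    · exact absurd hij.symm (hv i' i j h1)
    · exact ι.injective hij
  have hmap : ∀ p, (transversal p).map ⟨f, hf⟩ = Finset.univ.map
      ⟨fun i => f ⟨i, p i⟩, fun i i' h => congrArg Sigma.fst (hf h)⟩ := fun p => by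
    rw [transversal, Finset.map_map]
    rfl
  have hz : (transversal z).map ⟨f, hf⟩ = Finset.univ.map v := by
    rw [hmap]
    congr 1
    ext i
    simp [f]
  refine .step ⟨f, hf⟩ (map_univ_mem_complete v) ⟨_, mem_completePartite.2 ⟨z, rfl⟩, hz⟩
    fun s hs hne => ?_
  obtain ⟨p, rfl⟩ := mem_completePartite.1 hs
  rw [hmap]
  refine h _ (fun i => ?_) ?_
  · by_cases hi : p i = z i
    · exact .inl (by simp [f, hi])
    · exact .inr ⟨p i, hi, by simp [f, hi]⟩
  · have hpz : p ≠ z := fun h => hne (by rw [h, hz])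
    obtain ⟨i, hi⟩ := Function.ne_iff.1 hpz
    exact ⟨i, p i, hi, by simp [f, hi]⟩

theorem card_filter_two_le_card_inter_le {m n : ℕ} (R : Finset (Fin n)) :
    ((complete (m + 2) n).filter fun e => 2 ≤ (e ∩ R).card).card ≤
      R.card * R.card * n.choose m := by
  have hsub : ((complete (m + 2) n).filter fun e => 2 ≤ (e ∩ R).card) ⊆
      ((R ×ˢ R) ×ˢ Finset.powersetCard m Finset.univ).image
        fun x => insert x.1.1 (insert x.1.2 x.2) := by
    intro e he
    obtain ⟨he1, he2⟩ := Finset.mem_filter.1 he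
    have hcard := (Finset.mem_powersetCard.1 he1).2
    obtain ⟨a, ha, b, hb, hab⟩ := Finset.one_lt_card.1 he2
    rw [Finset.mem_inter] at ha hb
    have hb' : b ∈ e.erase a := Finset.mem_erase.2 ⟨hab.symm, hb.1⟩
    refine Finset.mem_image.2 ⟨((a, b), (e.erase a).erase b), ?_, ?_⟩
    · simp [ha.2, hb.2, Finset.card_erase_of_mem hb', Finset.card_erase_of_mem ha.1, hcard]
    · rw [Finset.insert_erase hb', Finset.insert_erase ha.1]
  refine (Finset.card_le_card hsub).trans (Finset.card_image_le.trans ?_)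
  simp [Finset.card_product]

theorem card_filter_inter_nonempty_le {m n : ℕ} (T : Finset (Fin n)) :
    ((complete (m + 1) n).filter fun e => (e ∩ T).Nonempty).card ≤ T.card * n.choose m := by
  have hsub : ((complete (m + 1) n).filter fun e => (e ∩ T).Nonempty) ⊆
      (T ×ˢ Finset.powersetCard m Finset.univ).image fun x => insert x.1 x.2 := by
    intro e he
    obtain ⟨he1, a, ha⟩ := Finset.mem_filter.1 he
    have hcard := (Finset.mem_powersetCard.1 he1).2
    rw [Finset.mem_inter] at ha
    refine Finset.mem_image.2 ⟨(a, e.erase a), ?_, ?_⟩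
    · simp [ha.2, Finset.card_erase_of_mem ha.1, hcard]
    · rw [Finset.insert_erase ha.1]
  refine (Finset.card_le_card hsub).trans (Finset.card_image_le.trans ?_)
  simp [Finset.card_product]

/-- Edges meeting the core `R` exactly once are generated before those missing `R`; for the latter,
every other edge of the copy from `Generates.of_core` meets `R`. -/
theorem wsat_le_mul_choose {m n : ℕ} {r : Fin (m + 2) → ℕ} (hr : ∀ i, 1 ≤ r i)
    (hn : ∑ i, r i ≤ n) :
    wsat (complete (m + 2) n) (completePartite (m + 2) r) ≤
      (∑ i, r i) * (∑ i, r i) * n.choose m + (r 0 - 1) * n.choose (m + 1) := by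
  classical
  obtain ⟨ι⟩ : Nonempty ((Σ i, Fin (r i)) ↪ Fin n) := by
    apply Function.Embedding.nonempty_of_card_le
    simpa using hn
  let z : ∀ i, Fin (r i) := fun i => ⟨0, hr i⟩
  let R : Finset (Fin n) := Finset.univ.map ι
  have hR : R.card = ∑ i, r i := by simp [R]
  have hιR : ∀ x, ι x ∈ R := fun x => Finset.mem_map_of_mem _ (Finset.mem_univ _)
  -- The `r 0 - 1` non-base vertices of part `0`: the edges through them account for the leading
  -- term.
  let T : Finset (Fin n) := (Finset.univ.erase (z 0)).image fun j => ι ⟨0, j⟩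
  have hT : T.card ≤ r 0 - 1 := Finset.card_image_le.trans (by simp)
  have hιT : ∀ j ≠ z 0, ι ⟨0, j⟩ ∈ T := fun j hj =>
    Finset.mem_image_of_mem _ (Finset.mem_erase.2 ⟨hj, Finset.mem_univ _⟩)
  let G := (complete (m + 2) n).filter (fun e => 2 ≤ (e ∩ R).card) ∪
    (complete (m + 2) n).filter fun e => (e ∩ T).Nonempty
  have hGR : ∀ e ∈ complete (m + 2) n, ∀ a ∈ e, ∀ b ∈ e, a ≠ b → a ∈ R → b ∈ R → e ∈ G := by
    intro e he a ha b hb hab haR hbR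
    refine Finset.mem_union_left _ (Finset.mem_filter.2 ⟨he, ?_⟩)
    exact Finset.one_lt_card.2
      ⟨a, Finset.mem_inter.2 ⟨ha, haR⟩, b, Finset.mem_inter.2 ⟨hb, hbR⟩, hab⟩
  have hGT : ∀ e ∈ complete (m + 2) n, ∀ a ∈ e, a ∈ T → e ∈ G := fun e he a ha haT =>
    Finset.mem_union_right _ (Finset.mem_filter.2 ⟨he, a, Finset.mem_inter.2 ⟨ha, haT⟩⟩)
  have hmem : ∀ (w : Fin (m + 2) ↪ Fin n) i, w i ∈ Finset.univ.map w := fun w i =>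
    Finset.mem_map_of_mem _ (Finset.mem_univ _)
  have hone : ∀ v : Fin (m + 2) ↪ Fin n, v 0 ∈ R → (∀ i ≠ 0, v i ∉ R) →
      Generates (complete (m + 2) n) (completePartite (m + 2) r) G (Finset.univ.map v) := by
    intro v hv0 hv
    by_cases hvT : v 0 ∈ T
    · exact .mem (hGT _ (map_univ_mem_complete v) _ (hmem v 0) hvT)
    obtain ⟨x, -, hx⟩ := Finset.mem_map.1 hv0
    -- Relabel the core so that `v 0` is the base vertex of part `0`. As `v 0 ∉ T`, the other
    -- vertices of that part stay put. Any other edge of the copy then meets `T`, or contains a core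
    -- vertex in part `0` and another one elsewhere.
    let κ := (Equiv.swap ⟨0, z 0⟩ x).toEmbedding.trans ι
    have hκ0 : κ ⟨0, z 0⟩ = v 0 := by simp [κ, hx]
    have hκR : ∀ y, κ y ∈ R := fun y => hιR _
    have hκT : ∀ j ≠ z 0, κ ⟨0, j⟩ ∈ T := by
      intro j hj
      have h : κ ⟨0, j⟩ = ι ⟨0, j⟩ := by
        simp only [κ, Function.Embedding.trans_apply, Equiv.coe_toEmbedding]
        rw [Equiv.swap_apply_of_ne_of_ne]
        · simpa using hj
        · rintro rfl
          exact hvT (hx ▸ hιT j hj)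
      rw [h]
      exact hιT j hj
    refine .of_core z κ v (fun i i' j hj h => ?_) fun w hw hex => ?_
    · by_cases hi : i = 0
      · subst hi
        rw [← hκ0] at h
        have h1 := κ.injective h
        cases h1
        exact hj rfl
      · exact hv i hi (h ▸ hκR _)
    · obtain ⟨i, j, hj, hij⟩ := hex
      by_cases hi : i = 0
      · subst hi
        exact .mem (hGT _ (map_univ_mem_complete w) _ (hmem w 0) (hij ▸ hκT j hj))
      · refine .mem (hGR _ (map_univ_mem_complete w) _ (hmem w 0) _ (hmem w i)
          (fun h => hi (w.injective h).symm) ?_ (hij ▸ hκR _))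
        rcases hw 0 with h | ⟨j', -, h⟩
        · rw [h]; exact hv0
        · rw [h]; exact hκR _
  have hmeet : ∀ e ∈ complete (m + 2) n, ∀ a ∈ e, a ∈ R →
      Generates (complete (m + 2) n) (completePartite (m + 2) r) G e := by
    intro e he a hae haR
    by_cases h2 : ∃ b ∈ e, a ≠ b ∧ b ∈ R
    · obtain ⟨b, hbe, hab, hbR⟩ := h2
      exact .mem (hGR e he a hae b hbe hab haR hbR)
    obtain ⟨v, rfl, rfl⟩ := exists_embedding_map_univ_eq (Finset.mem_powersetCard.1 he).2 hae
    exact hone v haR fun i hi hiR => h2 ⟨v i, hmem v i, fun h => hi (v.injective h).symm, hiR⟩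
  refine (wsat_le (G := G) ?_ fun e he => ?_).trans ?_
  · exact Finset.union_subset (Finset.filter_subset _ _) (Finset.filter_subset _ _)
  · by_cases h : ∃ a ∈ e, a ∈ R
    · obtain ⟨a, hae, haR⟩ := h
      exact hmeet e he a hae haR
    have hcard := (Finset.mem_powersetCard.1 he).2
    obtain ⟨a, ha⟩ : e.Nonempty := Finset.card_pos.1 (by omega)
    obtain ⟨v, rfl, rfl⟩ := exists_embedding_map_univ_eq hcard ha
    refine .of_core z ι v (fun i i' j _ hij => h ⟨v i, hmem v i, hij ▸ hιR _⟩) fun w _ hex => ?_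
    obtain ⟨i, j, -, hij⟩ := hex
    exact hmeet _ (map_univ_mem_complete w) _ (hmem w i) (hij ▸ hιR _)
  · refine (Finset.card_union_le _ _).trans (add_le_add ?_ ?_)
    · rw [← hR]
      exact card_filter_two_le_card_inter_le R
    · exact (card_filter_inter_nonempty_le T).trans (Nat.mul_le_mul_right _ hT)

end UpperBound

/-! ### Passing from binomial bounds to the asymptotic formula -/

section Asymptotics

open Filter

theorem pow_sub_sub_pow_le {x c : ℝ} (hc : 0 ≤ c) (hcx : c ≤ x) (k : ℕ) :
    x ^ (k + 1) - (x - c) ^ (k + 1) ≤ (k + 1) * c * x ^ k := by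
  induction k with
  | zero => simp
  | succ k ih =>
    have hx : 0 ≤ x := hc.trans hcx
    have h1 : (x - c) ^ (k + 1) ≤ x ^ (k + 1) :=
      pow_le_pow_left₀ (by linarith) (by linarith) _
    have h2 := mul_le_mul_of_nonneg_left ih hx
    have h3 := mul_le_mul_of_nonneg_left h1 hc
    push_cast
    calc x ^ (k + 1 + 1) - (x - c) ^ (k + 1 + 1)
        = x * (x ^ (k + 1) - (x - c) ^ (k + 1)) + c * (x - c) ^ (k + 1) := by ring
      _ ≤ x * ((k + 1) * c * x ^ k) + c * x ^ (k + 1) := add_le_add h2 h3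
      _ = _ := by ring

/-- The binomial coefficient is at least `(n - T - m) ^ (m + 1) / (m + 1)!`. The constant is crude:
the factorial is dropped from the error term. -/
theorem pow_div_factorial_sub_choose_le {n T m : ℕ} (h : T + m ≤ n) :
    (n : ℝ) ^ (m + 1) / (m + 1).factorial - (n - T).choose (m + 1) ≤
      (m + 1) * (T + m) * (n : ℝ) ^ m := by
  have hpos : (0 : ℝ) < (m + 1).factorial := by exact_mod_cast Nat.factorial_pos _
  have hone : (1 : ℝ) ≤ (m + 1).factorial := by exact_mod_cast Nat.factorial_pos _
  have h1 : ((n : ℝ) - (T + m)) ^ (m + 1) ≤ (m + 1).factorial * (n - T).choose (m + 1) := by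
    have := Nat.pow_sub_le_descFactorial (n - T) (m + 1)
    rw [Nat.descFactorial_eq_factorial_mul_choose,
      show n - T + 1 - (m + 1) = n - (T + m) by omega] at this
    have h2 : (((n - (T + m) : ℕ) : ℝ)) ^ (m + 1) ≤
        (m + 1).factorial * (n - T).choose (m + 1) := by exact_mod_cast this
    rwa [Nat.cast_sub h, Nat.cast_add] at h2
  have h2 := pow_sub_sub_pow_le (x := n) (c := T + m) (by positivity) (by exact_mod_cast h) m
  have h3 : (0 : ℝ) ≤ (m + 1) * (T + m) * (n : ℝ) ^ m := by positivity
  have h4 := mul_le_mul_of_nonneg_right hone h3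
  rw [sub_le_iff_le_add, div_le_iff₀ hpos]
  linarith

theorem isBigO_wsat_completePartite {m : ℕ} {r : Fin (m + 2) → ℕ} (hr : ∀ i, 1 ≤ r i)
    (hmono : Monotone r) :
    Asymptotics.IsBigO atTop
      (fun n : ℕ => (wsat (complete (m + 2) n) (completePartite (m + 2) r) : ℝ) -
        ((r 0 : ℝ) - 1) / (Nat.factorial (m + 1) : ℝ) * (n : ℝ) ^ (m + 1))
      (fun n : ℕ => (n : ℝ) ^ m) := by
  obtain ⟨T, hT⟩ : ∃ T, r 0 = T + 1 := ⟨r 0 - 1, by have := hr 0; omega⟩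
  set N := ∑ i, r i with hN
  refine Asymptotics.IsBigO.of_bound (N * N + T * ((m + 1) * (T + m))) ?_
  filter_upwards [eventually_ge_atTop N, eventually_ge_atTop (T + m)] with n hnN hnT
  have hup : (wsat (complete (m + 2) n) (completePartite (m + 2) r) : ℝ) ≤
      N * N * n.choose m + T * n.choose (m + 1) := by
    have := wsat_le_mul_choose hr hnN
    rw [hT, Nat.add_sub_cancel] at this
    exact_mod_cast this
  have hlow : (T : ℝ) * (n - T).choose (m + 1) ≤
      wsat (complete (m + 2) n) (completePartite (m + 2) r) := by
    -- Monotonicity makes `r 0` the smallest part, so every part has the `T + 1` vertices that the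
    -- divided differences need.
    exact_mod_cast mul_choose_le_wsat (fun i => hT ▸ hmono (Fin.zero_le i)) (by omega)
  have hc1 : (n.choose m : ℝ) ≤ (n : ℝ) ^ m := by exact_mod_cast Nat.choose_le_pow n m
  have hc2 : (n.choose (m + 1) : ℝ) ≤ (n : ℝ) ^ (m + 1) / (m + 1).factorial :=
    Nat.choose_le_pow_div (m + 1) n
  have hc3 := mul_le_mul_of_nonneg_left (pow_div_factorial_sub_choose_le hnT)
    (Nat.cast_nonneg (α := ℝ) T)
  have hc4 := mul_le_mul_of_nonneg_left hc1 (by positivity : (0 : ℝ) ≤ N * N)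
  have hc5 := mul_le_mul_of_nonneg_left hc2 (Nat.cast_nonneg (α := ℝ) T)
  have hc6 : (0 : ℝ) ≤ T * ((m + 1) * (T + m)) * (n : ℝ) ^ m := by positivity
  have hc7 : (0 : ℝ) ≤ N * N * (n : ℝ) ^ m := by positivity
  have hmain : ((r 0 : ℝ) - 1) / (Nat.factorial (m + 1) : ℝ) * (n : ℝ) ^ (m + 1) =
      T * ((n : ℝ) ^ (m + 1) / (m + 1).factorial) := by
    rw [hT]
    push_cast
    ring
  rw [hmain, Real.norm_eq_abs, Real.norm_of_nonneg (by positivity), abs_le]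
  constructor <;> nlinarith

end Asymptotics

end WeakSat

theorem theorem3 :
    (∀ (W : Type*) [Fintype W] (H : SimpleGraph W), H.IsBipartite → H ≠ ⊥ →
      ∃ c : ℝ,
        Filter.Tendsto
          (fun n : ℕ => (WeakSat.wsat (WeakSat.complete 2 n) (WeakSat.ofGraph H) : ℝ) / (n : ℝ))
          Filter.atTop (nhds c) ∧
        Filter.Tendsto
          (fun n : ℕ =>
            (WeakSat.wsat (WeakSat.ofGraph (completeBipartiteGraph (Fin n) (Fin n)))
              (WeakSat.ofGraph H) : ℝ) / (2 * (n : ℝ)))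
          Filter.atTop (nhds c)) ∧
    (∀ (d : ℕ) (hd : 2 ≤ d) (r : Fin d → ℕ), (∀ i, 1 ≤ r i) → Monotone r →
      Asymptotics.IsBigO Filter.atTop
        (fun n : ℕ =>
          (WeakSat.wsat (WeakSat.complete d n) (WeakSat.completePartite d r) : ℝ) -
            ((r ⟨0, by omega⟩ : ℝ) - 1) / (Nat.factorial (d - 1) : ℝ) * (n : ℝ) ^ (d - 1))
        (fun n : ℕ => (n : ℝ) ^ (d - 2))) := by
  refine ⟨fun W _ H hH hne => WeakSat.exists_tendsto_wsat_bipartite hH hne, ?_⟩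
  intro d hd r hr hmono
  obtain ⟨m, rfl⟩ : ∃ m, d = m + 2 := ⟨d - 2, by omega⟩
  exact WeakSat.isBigO_wsat_completePartite hr hmono
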